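/- Let $(X,d)$ be a compact metric space of positive Hausdorff dimension $\dim X\in(0,+\infty]$. Let $\mathscr W_2(X)$ be the set of Borel probability measures on $X$ (all of which have finite second moment), endowed with the metric $$W_2(\mu,\nu)=\Big(\inf_\Pi\int_{X\times X}d(x,y)^2\,\Pi(dx\,dy)\Big)^{1/2},$$ where $\Pi$ runs over the probability measures on $X\times X$ with marginals $\mu$ and $\nu$. For a family $\mathscr F=(f_s)_{s\in I}$ of continuous non-decreasing functions $f_s:[0,T_s)\to[0,+\infty)$ with $f_s(0)=0$, indexed by an interval $I\subset\mathbb R$ and such that $f_t(Cr)=o(f_s(r))$ as $r\to0$ for all $s<t$ in $I$ and all $C\ge1$ (a scale), and for a metric space $Y$, set $$\Lambda_{f_s}(Y)=\lim_{\delta\to0}\ \inf\Big\{\sum_{i=1}^\infty f_s(\operatorname{diam}E_i)\ \Big|\ Y=\bigcup_i E_i,\ E_i\text{ closed},\ \operatorname{diam}E_i\le\delta\Big\},\qquad \operatorname{crit}_{\mathscr F}Y=\sup\{s\in I\mid\Lambda_{f_s}(Y)=+\infty\},$$ the supremum being taken in the closure of $I$ in $[-\infty,+\infty]$ (so that $\sup\emptyset=\inf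 I$). Consider the scales $$\mathscr I=\Big(r\mapsto e^{-(\log\frac1r)^s}\Big)_{s\in[1,+\infty)},\qquad \mathscr I_2=\Big(r\mapsto e^{-s(\log\frac1r)^2}\Big)_{s\in(0,+\infty)},$$ the functions being defined on $(0,1)$ and extended by $0$ at $r=0$. Then $\mathscr W_2(X)$ has at least intermediate size, that is, $\operatorname{crit}_{\mathscr I}\mathscr W_2(X)$ is larger than its minimal possible value $1$. More precisely, $$\operatorname{crit}_{\mathscr I}\mathscr W_2(X)\ \geqslant\ 2,\qquad \operatorname{crit}_{\mathscr I_2}\mathscr W_2(X)\ \geqslant\ \frac{\dim X}{2\log 3}$$ (the last right-hand side being $+\infty$ when $\dim X=+\infty$). -/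

import Mathlib

open MeasureTheory Filter Topology
open scoped ENNReal NNReal ProbabilityTheory

noncomputable section

/-! ## Carathéodory's construction, scales and critical parameters -/

/-- Carathéodory's construction `Λ_f (A)`: the limit as `δ → 0` of the infimum of
`∑ f (diam E_i)` over countable closed coverings of `A` by sets of diameter at most `δ`.
The infimum is monotone in `δ`, so that the limit is the supremum over `δ > 0`; in particular only
the values of `f` close to `0` matter. The values of `f` on small nonnegative reals are assumed
nonnegative wherever this is used. -/
def caratheodoryMeasure {X : Type*} [MetricSpace X] (f : ℝ → ℝ) (A : Set X) : ℝ≥0∞ :=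
  ⨆ (δ : ℝ) (_ : 0 < δ),
    ⨅ (E : ℕ → Set X) (_ : ∀ i, IsClosed (E i)) (_ : A ⊆ ⋃ i, E i)
      (_ : ∀ i, Metric.ediam (E i) ≤ ENNReal.ofReal δ),
      ∑' i, ENNReal.ofReal (f (Metric.diam (E i)))

/-- A scale: a family of continuous non-decreasing functions `f_s : [0, T_s) → [0, ∞)` with
`f_s (0) = 0`, indexed by a nonempty interval `I` of reals, with the separation property
`f_t (C r) = o (f_s (r))` as `r → 0`, for all `s < t` in `I` and all `C ≥ 1`. -/
structure Scale where
  /-- the interval of parameters -/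
  I : Set ℝ
  ordConnected : I.OrdConnected
  nonempty : I.Nonempty
  /-- the right end point of the domain of `f_s` (possibly `+∞`) -/
  T : ℝ → EReal
  /-- the functions; only the values of `f s` on `[0, T s)` for `s ∈ I` are meaningful -/
  f : ℝ → ℝ → ℝ
  T_pos : ∀ s ∈ I, 0 < T s
  continuousOn : ∀ s ∈ I, ContinuousOn (f s) {r : ℝ | 0 ≤ r ∧ (r : EReal) < T s}
  monotoneOn : ∀ s ∈ I, MonotoneOn (f s) {r : ℝ | 0 ≤ r ∧ (r : EReal) < T s}
  map_zero : ∀ s ∈ I, f s 0 = 0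
  separation : ∀ s ∈ I, ∀ t ∈ I, s < t → ∀ C : ℝ, 1 ≤ C →
    (fun r => f t (C * r)) =o[𝓝[>] 0] (f s)

/-- The critical parameter `sup {s ∈ I | Λ_{f_s} (A) = +∞}`, the supremum being taken in the closure
of the interval `I` in the extended real line (so that the supremum of the empty set is `inf I`). -/
def Scale.crit (F : Scale) {X : Type*} [MetricSpace X] (A : Set X) : EReal :=
  (⨅ s ∈ F.I, (s : EReal)) ⊔
    ⨆ (s : ℝ) (_ : s ∈ F.I) (_ : caratheodoryMeasure (F.f s) A = ∞), (s : EReal)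

/-! ## The intermediate scales -/

/-- The function `r ↦ exp (-c (log (1/r)) ^ σ)`, extended by `0` at `0`. -/
def powLogExp (c σ : ℝ) (r : ℝ) : ℝ :=
  if r = 0 then 0 else Real.exp (-(c * Real.log (1 / r) ^ σ))

theorem powLogExp_zero (c σ : ℝ) : powLogExp c σ 0 = 0 := by simp [powLogExp]

theorem tendsto_log_one_div : Tendsto (fun r : ℝ => Real.log (1 / r)) (𝓝[>] 0) atTop := by
  simp only [one_div]
  exact Real.tendsto_log_atTop.comp tendsto_inv_nhdsGT_zero

theorem powLogExp_monotoneOn {c σ : ℝ} (hc : 0 < c) (hσ : 1 ≤ σ) :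
    MonotoneOn (powLogExp c σ) {r : ℝ | 0 ≤ r ∧ (r : EReal) < 1} := by
  rintro r ⟨hr0, -⟩ r' ⟨-, hr1⟩ hrr
  have hr1' : r' < 1 := by exact_mod_cast hr1
  rcases hr0.eq_or_lt with rfl | hr
  · rw [powLogExp_zero]
    unfold powLogExp
    split_ifs <;> positivity
  · have hr' : 0 < r' := hr.trans_le hrr
    rw [powLogExp, powLogExp, if_neg hr.ne', if_neg hr'.ne', Real.exp_le_exp, neg_le_neg_iff]
    have h0 : 0 ≤ Real.log (1 / r') := Real.log_nonneg (by rw [le_div_iff₀ hr']; linarith)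
    gcongr

theorem powLogExp_continuousOn {c σ : ℝ} (hc : 0 < c) (hσ : 1 ≤ σ) :
    ContinuousOn (powLogExp c σ) {r : ℝ | 0 ≤ r ∧ (r : EReal) < 1} := by
  rintro r ⟨hr0, hr1⟩
  rcases hr0.eq_or_lt with rfl | hr
  · have h1 : Tendsto (powLogExp c σ) (𝓝[>] 0) (𝓝 0) := by
      have h2 : Tendsto (fun r : ℝ => Real.exp (-(c * Real.log (1 / r) ^ σ))) (𝓝[>] 0) (𝓝 0) :=
        Real.tendsto_exp_neg_atTop_nhds_zero.comp
          (((tendsto_rpow_atTop (by linarith)).comp tendsto_log_one_div).const_mul_atTop hc)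
      refine h2.congr' ?_
      filter_upwards [self_mem_nhdsWithin] with r hr
      rw [powLogExp, if_neg (ne_of_gt hr)]
    have h3 : ContinuousWithinAt (powLogExp c σ) (Set.Ici 0) 0 := by
      rw [← continuousWithinAt_Ioi_iff_Ici, ContinuousWithinAt, powLogExp_zero]
      exact h1
    exact h3.mono fun x hx => hx.1
  · have hc1 : ContinuousAt (fun r : ℝ => Real.exp (-(c * Real.log (1 / r) ^ σ))) r := by
      have hlog : ContinuousAt (fun r : ℝ => Real.log (1 / r)) r :=
        (continuousAt_const.div continuousAt_id hr.ne').log (by simpa using hr.ne')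
      exact ((hlog.rpow_const (Or.inr (by linarith))).const_mul c).neg.rexp
    refine (hc1.congr ?_).continuousWithinAt
    filter_upwards [lt_mem_nhds hr] with x hx
    rw [powLogExp, if_neg (ne_of_gt hx)]

theorem powLogExp_isLittleO {c σ c' σ' : ℝ} (hσ : 1 ≤ σ) (hc' : 0 < c')
    (h : σ < σ' ∨ σ = σ' ∧ c < c') {C : ℝ} (hC : 1 ≤ C) :
    (fun r => powLogExp c' σ' (C * r)) =o[𝓝[>] 0] (powLogExp c σ) := by
  have hC0 : 0 < C := by linarith
  have hrat : Tendsto (fun L : ℝ => ((L - Real.log C) / L) ^ σ') atTop (𝓝 1) := by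
    have h1 : Tendsto (fun L : ℝ => 1 - Real.log C / L) atTop (𝓝 (1 - 0)) :=
      tendsto_const_nhds.sub (tendsto_const_nhds.div_atTop tendsto_id)
    have h2 : Tendsto (fun L : ℝ => (L - Real.log C) / L) atTop (𝓝 1) := by
      rw [sub_zero] at h1
      refine h1.congr' ?_
      filter_upwards [eventually_gt_atTop 0] with L hL
      field_simp
    simpa using h2.rpow_const (Or.inl one_ne_zero) (p := σ')
  have hpow : Tendsto (fun L : ℝ => L ^ σ) atTop atTop := tendsto_rpow_atTop (by linarith)
  have hmain : Tendsto (fun L : ℝ => c' * (L - Real.log C) ^ σ' - c * L ^ σ) atTop atTop := by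
    have key : Tendsto (fun L : ℝ => (c' * ((L - Real.log C) / L) ^ σ' * L ^ (σ' - σ) - c) * L ^ σ)
        atTop atTop := by
      rcases h with h | ⟨rfl, h⟩
      · refine Tendsto.atTop_mul_atTop₀ (tendsto_atTop_add_const_right _ _ ?_) hpow
        exact (hrat.const_mul c').pos_mul_atTop (by simpa using hc')
          (tendsto_rpow_atTop (by linarith))
      · refine Tendsto.pos_mul_atTop (C := c' - c) (by linarith) ?_ hpow
        simpa using (hrat.const_mul c').sub_const c
    refine key.congr' ?_
    filter_upwards [eventually_gt_atTop 0, eventually_gt_atTop (Real.log C)] with L hL hLC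
    rw [Real.div_rpow (by linarith) hL.le, Real.rpow_sub hL]
    have := (Real.rpow_pos_of_pos hL σ).ne'
    have := (Real.rpow_pos_of_pos hL σ').ne'
    field_simp
  have hexp := Real.tendsto_exp_neg_atTop_nhds_zero.comp (hmain.comp tendsto_log_one_div)
  have hne : ∀ᶠ r : ℝ in 𝓝[>] 0, powLogExp c σ r = 0 → powLogExp c' σ' (C * r) = 0 := by
    filter_upwards [self_mem_nhdsWithin] with r hr h0
    rw [powLogExp, if_neg (ne_of_gt hr)] at h0
    exact absurd h0 (Real.exp_pos _).ne'
  rw [Asymptotics.isLittleO_iff_tendsto' hne]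
  refine hexp.congr' ?_
  filter_upwards [self_mem_nhdsWithin] with r hr
  have hr : 0 < r := hr
  rw [powLogExp, powLogExp, if_neg hr.ne', if_neg (mul_pos hC0 hr).ne', ← Real.exp_sub]
  have : Real.log (1 / (C * r)) = Real.log (1 / r) - Real.log C := by
    rw [one_div, one_div, Real.log_inv, Real.log_inv, Real.log_mul hC0.ne' hr.ne']
    ring
  rw [this]
  simp only [Function.comp]
  congr 1
  ring

/-- The coarse intermediate scale `(r ↦ exp (-(log (1/r)) ^ s))`, `s ∈ [1, ∞)`. -/
def coarseIntermediateScale : Scale where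
  I := Set.Ici 1
  ordConnected := Set.ordConnected_Ici
  nonempty := Set.nonempty_Ici
  T := fun _ => 1
  f := fun s => powLogExp 1 s
  T_pos := fun _ _ => zero_lt_one
  continuousOn := fun _ hs => powLogExp_continuousOn one_pos hs
  monotoneOn := fun _ hs => powLogExp_monotoneOn one_pos hs
  map_zero := fun _ _ => powLogExp_zero _ _
  separation := fun _ hs _ _ hst _ hC => powLogExp_isLittleO hs one_pos (Or.inl hst) hC

/-- The fine intermediate scale `(r ↦ exp (-s (log (1/r)) ^ σ))`, `s ∈ (0, ∞)`, for given
`σ ∈ [1, ∞)`. -/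
def fineIntermediateScale (σ : ℝ) (hσ : 1 ≤ σ) : Scale where
  I := Set.Ioi 0
  ordConnected := Set.ordConnected_Ioi
  nonempty := Set.nonempty_Ioi
  T := fun _ => 1
  f := fun s => powLogExp s σ
  T_pos := fun _ _ => zero_lt_one
  continuousOn := fun _ hs => powLogExp_continuousOn hs hσ
  monotoneOn := fun _ hs => powLogExp_monotoneOn hs hσ
  map_zero := fun _ _ => powLogExp_zero _ _
  separation := fun _ _ _ ht hst _ hC => powLogExp_isLittleO hσ ht (Or.inr ⟨rfl, hst⟩) hC

/-- A metric space has at least intermediate size if its critical parameter in the coarse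
intermediate scale is larger than `1`, the minimal possible value. -/
def HasAtLeastIntermediateSize (X : Type*) [MetricSpace X] : Prop :=
  1 < coarseIntermediateScale.crit (Set.univ : Set X)

/-! ## The quadratic Wasserstein space -/

/-- The underlying set of the quadratic Wasserstein space: Borel probability measures with finite
second moment. -/
structure WassersteinTwo (X : Type*) [MetricSpace X] [MeasurableSpace X] where
  /-- the underlying measure -/
  measure : Measure X
  isProbabilityMeasure : IsProbabilityMeasure measure
  finite_moment : ∃ x₀, ∫⁻ x, edist x₀ x ^ 2 ∂measure < ∞

/-- `Π` is a transport plan between `μ` and `ν`: its marginals are `μ` and `ν`. (It is then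
automatically a probability measure if `μ` and `ν` are.) -/
def IsTransportPlan {X : Type*} [MeasurableSpace X] (P : Measure (X × X)) (μ ν : Measure X) : Prop :=
  P.fst = μ ∧ P.snd = ν

/-- The infimum over all transport plans of the total quadratic cost. -/
def transportCost {X : Type*} [MetricSpace X] [MeasurableSpace X] (μ ν : Measure X) : ℝ≥0∞ :=
  ⨅ (P : Measure (X × X)) (_ : IsTransportPlan P μ ν), ∫⁻ q, edist q.1 q.2 ^ 2 ∂P

/-- The quadratic Wasserstein distance, with values in `[0, ∞]`. -/
def wassersteinEDist {X : Type*} [MetricSpace X] [MeasurableSpace X] (μ ν : Measure X) : ℝ≥0∞ :=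
  transportCost μ ν ^ (1 / 2 : ℝ)

theorem IsTransportPlan.isProbabilityMeasure {X : Type*} [MeasurableSpace X] {P : Measure (X × X)} {μ ν : Measure X}
    [IsProbabilityMeasure μ] (h : IsTransportPlan P μ ν) : IsProbabilityMeasure P :=
  ⟨by rw [← Measure.fst_univ, h.1, measure_univ]⟩

theorem exists_gluing {X : Type*} [MeasurableSpace X] [StandardBorelSpace X] {P Q : Measure (X × X)} [IsProbabilityMeasure P]
    [IsProbabilityMeasure Q] (h : P.snd = Q.fst) :
    ∃ G : Measure (X × (X × X)), G.map (fun q => (q.2.1, q.1)) = P ∧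
      G.map (fun q => (q.1, q.2.2)) = Q := by
  have hne : Nonempty X := by
    by_contra hX
    rw [not_nonempty_iff] at hX
    have := measure_univ (μ := P)
    simp [Set.univ_eq_empty_iff.2 (inferInstance : IsEmpty (X × X))] at this
  set P' : Measure (X × X) := P.map Prod.swap with hP'
  have : IsProbabilityMeasure P' := Measure.isProbabilityMeasure_map (by fun_prop)
  have hP'fst : P'.fst = P.snd := by rw [hP', Measure.fst_map_swap]
  set ν := Q.fst with hν
  refine ⟨ν ⊗ₘ (P'.condKernel ×ₖ Q.condKernel), ?_, ?_⟩
  · have h1 : (ν ⊗ₘ (P'.condKernel ×ₖ Q.condKernel)).map (Prod.map id Prod.fst) = P' := by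
      rw [← Measure.compProd_map measurable_fst, ← ProbabilityTheory.Kernel.fst_eq,
        ProbabilityTheory.Kernel.fst_prod, ← h, ← hP'fst]
      exact P'.disintegrate P'.condKernel
    have h2 : P = P'.map Prod.swap := by
      rw [hP', Measure.map_map (by fun_prop) (by fun_prop)]
      simp
    refine Eq.trans ?_ ((congrArg (Measure.map Prod.swap) h1).trans h2.symm)
    rw [Measure.map_map (by fun_prop) (by fun_prop)]
    rfl
  · have h1 : (ν ⊗ₘ (P'.condKernel ×ₖ Q.condKernel)).map (Prod.map id Prod.snd) = Q := by
      rw [← Measure.compProd_map measurable_snd, ← ProbabilityTheory.Kernel.snd_eq,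
        ProbabilityTheory.Kernel.snd_prod]
      exact Q.disintegrate Q.condKernel
    exact h1

section Wasserstein

variable {X : Type*} [MetricSpace X] [MeasurableSpace X]

theorem wassersteinEDist_self [OpensMeasurableSpace X] [SecondCountableTopology X]
    (μ : Measure X) : wassersteinEDist μ μ = 0 := by
  have h : transportCost μ μ = 0 := by
    refine le_antisymm (iInf₂_le_of_le (μ.map fun x => (x, x)) ⟨?_, ?_⟩ ?_) zero_le
    · rw [Measure.fst, Measure.map_map (by fun_prop) (by fun_prop)]
      exact Measure.map_id
    · rw [Measure.snd, Measure.map_map (by fun_prop) (by fun_prop)]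
      exact Measure.map_id
    · rw [lintegral_map (by fun_prop) (by fun_prop)]
      simp
  simp [wassersteinEDist, h]

theorem transportCost_comm_le [OpensMeasurableSpace X] [SecondCountableTopology X]
    (μ ν : Measure X) : transportCost μ ν ≤ transportCost ν μ := by
  refine le_iInf₂ fun P hP => iInf₂_le_of_le (P.map Prod.swap) ⟨?_, ?_⟩ ?_
  · rw [Measure.fst_map_swap, hP.2]
  · rw [Measure.snd_map_swap, hP.1]
  · rw [lintegral_map (by fun_prop) (by fun_prop)]
    simp [edist_comm]

theorem wassersteinEDist_le {μ ν : Measure X} {P : Measure (X × X)} (hP : IsTransportPlan P μ ν) :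
    wassersteinEDist μ ν ≤ (∫⁻ q, edist q.1 q.2 ^ 2 ∂P) ^ (1 / 2 : ℝ) :=
  ENNReal.rpow_le_rpow (iInf₂_le P hP) (by norm_num)

theorem exists_plan_of_lt {μ ν : Measure X} {a : ℝ≥0∞} (h : wassersteinEDist μ ν < a) :
    ∃ P, IsTransportPlan P μ ν ∧ (∫⁻ q, edist q.1 q.2 ^ 2 ∂P) ^ (1 / 2 : ℝ) < a := by
  have h2 : transportCost μ ν < a ^ (2 : ℝ) := by
    rw [wassersteinEDist] at h
    have := ENNReal.rpow_lt_rpow h (z := 2) (by norm_num)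
    rwa [← ENNReal.rpow_mul, show (1 / 2 : ℝ) * 2 = 1 by norm_num, ENNReal.rpow_one] at this
  simp only [transportCost, iInf_lt_iff] at h2
  obtain ⟨P, hP, hlt⟩ := h2
  refine ⟨P, hP, ?_⟩
  have := ENNReal.rpow_lt_rpow hlt (z := 1 / 2) (by norm_num)
  rwa [← ENNReal.rpow_mul, show (2 : ℝ) * (1 / 2) = 1 by norm_num, ENNReal.rpow_one] at this

theorem wassersteinEDist_triangle [BorelSpace X] [CompleteSpace X]
    [SecondCountableTopology X] (μ ν ρ : Measure X) [IsProbabilityMeasure μ]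
    [IsProbabilityMeasure ν] :
    wassersteinEDist μ ρ ≤ wassersteinEDist μ ν + wassersteinEDist ν ρ := by
  refine ENNReal.le_of_forall_pos_le_add fun ε hε hfin => ?_
  have hε' : (ε : ℝ≥0∞) / 2 ≠ 0 := by simpa using hε.ne'
  obtain ⟨P, hP, hPlt⟩ := exists_plan_of_lt
    (ENNReal.lt_add_right (ne_top_of_le_ne_top hfin.ne le_self_add) hε')
  obtain ⟨Q, hQ, hQlt⟩ := exists_plan_of_lt
    (ENNReal.lt_add_right (ne_top_of_le_ne_top hfin.ne le_add_self) hε')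
  have := hP.isProbabilityMeasure
  have := hQ.isProbabilityMeasure
  obtain ⟨G, hG1, hG2⟩ := exists_gluing (hP.2.trans hQ.1.symm)
  have hR : IsTransportPlan (G.map Prod.snd) μ ρ := by
    constructor
    · rw [← hP.1, ← hG1, Measure.fst, Measure.fst, Measure.map_map (by fun_prop) (by fun_prop),
        Measure.map_map (by fun_prop) (by fun_prop)]
      rfl
    · rw [← hQ.2, ← hG2, Measure.snd, Measure.snd, Measure.map_map (by fun_prop) (by fun_prop),
        Measure.map_map (by fun_prop) (by fun_prop)]
      rfl
  have hP' : ∫⁻ q, edist q.1 q.2 ^ 2 ∂P = ∫⁻ q, edist q.2.1 q.1 ^ (2 : ℝ) ∂G := by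
    rw [← hG1, lintegral_map (by fun_prop) (by fun_prop)]
    simp
  have hQ' : ∫⁻ q, edist q.1 q.2 ^ 2 ∂Q = ∫⁻ q, edist q.1 q.2.2 ^ (2 : ℝ) ∂G := by
    rw [← hG2, lintegral_map (by fun_prop) (by fun_prop)]
    simp
  calc wassersteinEDist μ ρ
      ≤ (∫⁻ q, edist q.1 q.2 ^ 2 ∂(G.map Prod.snd)) ^ (1 / 2 : ℝ) := wassersteinEDist_le hR
    _ = (∫⁻ q, edist q.2.1 q.2.2 ^ (2 : ℝ) ∂G) ^ (1 / 2 : ℝ) := by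
        rw [lintegral_map (by fun_prop) (by fun_prop)]
        simp
    _ ≤ (∫⁻ q, ((fun q : X × (X × X) => edist q.2.1 q.1) +
          fun q : X × (X × X) => edist q.1 q.2.2) q ^ (2 : ℝ) ∂G) ^ (1 / 2 : ℝ) := by
        gcongr with q
        exact edist_triangle _ _ _
    _ ≤ (∫⁻ q, edist q.2.1 q.1 ^ (2 : ℝ) ∂G) ^ (1 / 2 : ℝ) +
          (∫⁻ q, edist q.1 q.2.2 ^ (2 : ℝ) ∂G) ^ (1 / 2 : ℝ) :=
        ENNReal.lintegral_Lp_add_le (by fun_prop) (by fun_prop) (by norm_num)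
    _ ≤ (wassersteinEDist μ ν + ε / 2) + (wassersteinEDist ν ρ + ε / 2) := by
        rw [← hP', ← hQ']
        exact add_le_add hPlt.le hQlt.le
    _ = wassersteinEDist μ ν + wassersteinEDist ν ρ + ε := by
        rw [add_add_add_comm, ENNReal.add_halves]

theorem lintegral_edist_le_of_plan [OpensMeasurableSpace X] [SecondCountableTopology X]
    {P : Measure (X × X)} [IsProbabilityMeasure P] :
    ∫⁻ q, edist q.1 q.2 ∂P ≤ (∫⁻ q, edist q.1 q.2 ^ 2 ∂P) ^ (1 / 2 : ℝ) := by
  have := ENNReal.lintegral_mul_le_Lp_mul_Lq P (p := 2) (q := 2)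
    (by constructor <;> norm_num) (f := fun q : X × X => edist q.1 q.2) (g := fun _ => 1)
    (by fun_prop) (by fun_prop)
  simpa using this

theorem lintegral_le_of_wassersteinEDist_eq_zero [OpensMeasurableSpace X]
    [SecondCountableTopology X] {μ ν : Measure X} [IsProbabilityMeasure μ]
    (h : wassersteinEDist μ ν = 0) {K : ℝ≥0} {f : X → ℝ≥0} (hf : LipschitzWith K f) :
    ∫⁻ x, f x ∂μ ≤ ∫⁻ x, f x ∂ν := by
  have hfm : Measurable f := hf.continuous.measurable
  refine ENNReal.le_of_forall_pos_le_add fun ε hε _ => ?_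
  have hε' : (0 : ℝ≥0∞) < ε / (K + 1) :=
    ENNReal.div_pos (by simpa using hε.ne') (by simp)
  obtain ⟨P, hP, hPlt⟩ := exists_plan_of_lt (h.trans_lt hε')
  have := hP.isProbabilityMeasure
  have h1 : ∀ x y : X, (f x : ℝ≥0∞) ≤ f y + K * edist x y := fun x y => by
    have h2 := hf x y
    have h3 : (f x : ℝ≥0∞) ≤ f y + edist (f x) (f y) := by
      rw [edist_nndist, ← ENNReal.coe_add, ENNReal.coe_le_coe, NNReal.nndist_eq]
      exact tsub_le_iff_left.1 (le_max_left _ _)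
    exact h3.trans (by gcongr)
  calc ∫⁻ x, f x ∂μ = ∫⁻ q, f q.1 ∂P := by
        rw [← hP.1, Measure.fst, lintegral_map (by fun_prop) (by fun_prop)]
    _ ≤ ∫⁻ q, (f q.2 + K * edist q.1 q.2) ∂P := lintegral_mono fun q => h1 _ _
    _ = ∫⁻ q, f q.2 ∂P + K * ∫⁻ q, edist q.1 q.2 ∂P := by
        rw [lintegral_add_left (by fun_prop), lintegral_const_mul _ (by fun_prop)]
    _ = ∫⁻ x, f x ∂ν + K * ∫⁻ q, edist q.1 q.2 ∂P := by
        rw [← hP.2, Measure.snd, lintegral_map (by fun_prop) (by fun_prop)]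
    _ ≤ ∫⁻ x, f x ∂ν + (K + 1) * (ε / (K + 1)) := by
        gcongr
        · exact le_self_add
        · exact lintegral_edist_le_of_plan.trans hPlt.le
    _ = ∫⁻ x, f x ∂ν + ε := by
        rw [ENNReal.mul_div_cancel (by simp) (by simp)]

theorem eq_of_wassersteinEDist_eq_zero [BorelSpace X] [SecondCountableTopology X]
    {μ ν : Measure X} [IsProbabilityMeasure μ] [IsProbabilityMeasure ν]
    (h : wassersteinEDist μ ν = 0) : μ = ν := by
  have h' : wassersteinEDist ν μ = 0 := by
    rw [wassersteinEDist, ← le_zero_iff] at h ⊢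
    exact (ENNReal.rpow_le_rpow (transportCost_comm_le ν μ) (by norm_num)).trans h
  refine ext_of_generate_finite _ (BorelSpace.measurable_eq.trans borel_eq_generateFrom_isClosed)
    isPiSystem_isClosed (fun F hF => ?_) (by simp)
  have hδ : ∀ n : ℕ, (0 : ℝ) < 1 / ((n : ℝ) + 1) := fun n => by positivity
  have hlim := tendsto_one_div_add_atTop_nhds_zero_nat (𝕜 := ℝ)
  refine tendsto_nhds_unique (tendsto_lintegral_thickenedIndicator_of_isClosed μ hF hδ hlim) ?_
  refine (tendsto_lintegral_thickenedIndicator_of_isClosed ν hF hδ hlim).congr fun n => ?_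
  exact le_antisymm
    (lintegral_le_of_wassersteinEDist_eq_zero h' (lipschitzWith_thickenedIndicator (hδ n) F))
    (lintegral_le_of_wassersteinEDist_eq_zero h (lipschitzWith_thickenedIndicator (hδ n) F))

theorem wassersteinEDist_dirac_right [OpensMeasurableSpace X] [SecondCountableTopology X]
    (μ : Measure X) [IsProbabilityMeasure μ] (x₀ : X) :
    wassersteinEDist μ (Measure.dirac x₀) ≤ (∫⁻ x, edist x x₀ ^ 2 ∂μ) ^ (1 / 2 : ℝ) := by
  have h : IsTransportPlan (μ.map fun x => (x, x₀)) μ (Measure.dirac x₀) := by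
    constructor
    · rw [Measure.fst, Measure.map_map (by fun_prop) (by fun_prop)]
      exact Measure.map_id
    · rw [Measure.snd, Measure.map_map (by fun_prop) (by fun_prop)]
      change μ.map (fun _ => x₀) = _
      rw [Measure.map_const, measure_univ, one_smul]
  refine (wassersteinEDist_le h).trans_eq ?_
  rw [lintegral_map (by fun_prop) (by fun_prop)]

namespace WassersteinTwo

instance (μ : WassersteinTwo X) : IsProbabilityMeasure μ.measure := μ.isProbabilityMeasure

/-- The extended metric structure on the quadratic Wasserstein space of a Polish metric space. -/
abbrev emetricSpace [BorelSpace X] [CompleteSpace X] [SecondCountableTopology X] :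
    EMetricSpace (WassersteinTwo X) where
  edist μ ν := wassersteinEDist μ.measure ν.measure
  edist_self μ := wassersteinEDist_self _
  edist_comm μ ν := by
    unfold wassersteinEDist
    rw [(transportCost_comm_le _ _).antisymm (transportCost_comm_le _ _)]
  edist_triangle μ ν ρ := wassersteinEDist_triangle _ _ _
  eq_of_edist_eq_zero {μ ν} h := by
    have := eq_of_wassersteinEDist_eq_zero h
    cases μ
    cases ν
    congr

theorem wassersteinEDist_ne_top [BorelSpace X] [CompleteSpace X] [SecondCountableTopology X]
    (μ ν : WassersteinTwo X) : wassersteinEDist μ.measure ν.measure ≠ ∞ := by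
  let _ : EMetricSpace (WassersteinTwo X) := emetricSpace
  have hne : Nonempty X := μ.finite_moment.nonempty
  have key : ∀ μ : WassersteinTwo X,
      ∃ x₀, wassersteinEDist μ.measure (Measure.dirac x₀) < ∞ := by
    intro μ
    obtain ⟨x₀, hx₀⟩ := μ.finite_moment
    refine ⟨x₀, (wassersteinEDist_dirac_right _ x₀).trans_lt ?_⟩
    simp only [edist_comm _ x₀]
    exact ENNReal.rpow_lt_top_of_nonneg (by norm_num) hx₀.ne
  obtain ⟨x, hx⟩ := key μ
  obtain ⟨y, hy⟩ := key ν
  let D : X → WassersteinTwo X := fun z => ⟨Measure.dirac z, inferInstance, z, by simp⟩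
  have hxy : edist (D x) (D y) ≠ ∞ := by
    refine ((wassersteinEDist_dirac_right _ y).trans_lt ?_).ne
    refine ENNReal.rpow_lt_top_of_nonneg (by norm_num) ?_
    change ∫⁻ z, edist z y ^ 2 ∂(Measure.dirac x) ≠ ∞
    rw [lintegral_dirac' _ (by fun_prop)]
    finiteness
  have h1 : edist μ (D x) ≠ ∞ := hx.ne
  have h2 : edist (D y) ν ≠ ∞ := by rw [edist_comm]; exact hy.ne
  change edist μ ν ≠ ∞
  refine ne_top_of_le_ne_top ?_ (edist_triangle4 μ (D x) (D y) ν)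
  finiteness

/-- The quadratic Wasserstein space of a Polish metric space, as a metric space: the distance is
the square root of the infimum of the total quadratic costs of the transport plans. -/
instance instMetricSpace [BorelSpace X] [CompleteSpace X] [SecondCountableTopology X] :
    MetricSpace (WassersteinTwo X) :=
  let _ : EMetricSpace (WassersteinTwo X) := emetricSpace
  EMetricSpace.toMetricSpace wassersteinEDist_ne_top

theorem edist_def [BorelSpace X] [CompleteSpace X] [SecondCountableTopology X]
    (μ ν : WassersteinTwo X) : edist μ ν = wassersteinEDist μ.measure ν.measure := rfl

theorem dist_def [BorelSpace X] [CompleteSpace X] [SecondCountableTopology X]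
    (μ ν : WassersteinTwo X) :
    dist μ ν = (wassersteinEDist μ.measure ν.measure).toReal := rfl

end WassersteinTwo

end Wasserstein

end

/-! The Wasserstein space contains a Cantor set so spread out that both critical parameters are `⊤`;
the two stated bounds follow at once.

Positive dimension gives points `p 0, p 1, …` such that `p n` is at distance at least `η (n+1)^(-C)`
from all earlier ones (`exists_separated_seq`). Fix a probability `l` on `ℕ` with polynomially
decaying weights, and send a binary sequence `b` to the measure `Φ b` that puts the mass `l {n}` at
`p 0` or at `p (n+1)` according to the digit `b n`. If `b ≠ b'` agree from index `M` on, a bump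
function around one point shows that `Φ b` and `Φ b'` are at distance at least a constant times
`(M+1)^(-(C+2))` (`mul_le_wassersteinEDist_toggleMeasure`).

Hence, if a closed set `E` has diameter below this threshold, the `2^M` translates of `Φ ⁻¹' E` by
changes of the first `M` digits are disjoint, and its Haar mass is at most `2^(-M)`
(`measure_preimage_mul_two_pow_le`). For `diam E = r` one may take `M` of order `r^(-1/(C+2))`. So
the mass is exponentially small in a power of `1/r`, which beats `exp (-c (log (1/r))^σ)` for all
`c` and `σ`, and the mass distribution principle gives infinite Carathéodory measure. -/

noncomputable section

/-! ## Separated sequences in spaces of positive Hausdorff dimension -/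

section Separated

variable {X : Type*} [MetricSpace X]

/-- If no `n` closed balls of radius `ε n` cover the space, then there is a sequence whose `n`-th
term is at distance at least `ε n` from all previous ones. -/
theorem exists_seq_le_dist {ε : ℕ → ℝ}
    (h : ∀ l : List X, ∃ y, ∀ x ∈ l, ε l.length ≤ dist x y) :
    ∃ p : ℕ → X, ∀ m n, m < n → ε n ≤ dist (p m) (p n) := by
  choose g hg using h
  -- `S n` lists the first `n` chosen points, latest first; its length `n` selects the radius `ε n`.
  let S : ℕ → List X := fun n => Nat.rec [] (fun _ l => g l :: l) n
  have hS : ∀ n, S (n + 1) = g (S n) :: S n := fun n => rfl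
  have hlen : ∀ n, (S n).length = n := by
    intro n
    induction n with
    | zero => rfl
    | succ n ih => rw [hS, List.length_cons, ih]
  have hmem : ∀ m n, m < n → g (S m) ∈ S n := by
    intro m n hmn
    induction n with
    | zero => omega
    | succ n ih =>
      rw [hS, List.mem_cons]
      rcases Nat.lt_succ_iff_lt_or_eq.1 hmn with h | rfl
      · exact Or.inr (ih h)
      · exact Or.inl rfl
  refine ⟨fun n => g (S n), fun m n hmn => ?_⟩
  have := hg (S n) _ (hmem m n hmn)
  rwa [hlen] at this

/-- A space of positive Hausdorff dimension contains a sequence whose first `n` points are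
separated by a power of `1 / n`. -/
theorem exists_separated_seq [MeasurableSpace X] [BorelSpace X]
    (hX : 0 < dimH (Set.univ : Set X)) :
    ∃ η C : ℝ, 0 < η ∧ 0 < C ∧ ∃ p : ℕ → X, ∀ m n : ℕ, m < n →
      η * ((n : ℝ) + 1) ^ (-C) ≤ dist (p m) (p n) := by
  obtain ⟨d, hd0, hd⟩ := ENNReal.lt_iff_exists_nnreal_btwn.1 hX
  -- Below the dimension the Hausdorff measure is infinite; it is enough that at some scale `r` all
  -- covers have sum of `d`-th powers of diameters greater than `1`.
  have hd0 : (0 : ℝ) < d := by exact_mod_cast hd0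
  have hH : (1 : ℝ≥0∞) < Measure.hausdorffMeasure (d : ℝ) (Set.univ : Set X) := by
    rw [hausdorffMeasure_of_lt_dimH hd]
    exact ENNReal.one_lt_top
  rw [Measure.hausdorffMeasure_apply] at hH
  simp only [lt_iSup_iff] at hH
  obtain ⟨r, hr, hlt⟩ := hH
  obtain ⟨ρ, hρ0, hρr⟩ := ENNReal.lt_iff_exists_nnreal_btwn.1 hr
  have hρ0 : (0 : ℝ) < ρ := by exact_mod_cast hρ0
  -- With these constants a ball of radius `ε` has diameter at most `(n+1)^(-1/d)`, whose `d`-th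
  -- power is `1/(n+1)`, and also at most `ρ < r`. A cover by `n` such balls would have sum at most
  -- `n/(n+1) ≤ 1`.
  refine ⟨min 1 ρ / 2, 1 / d, half_pos (lt_min one_pos hρ0), one_div_pos.2 hd0, exists_seq_le_dist fun l => ?_⟩
  by_contra! hcon
  set n := l.length
  set ε : ℝ := min 1 (ρ : ℝ) / 2 * ((n : ℝ) + 1) ^ (-(1 / (d : ℝ))) with hε
  have hpow : ((n : ℝ) + 1) ^ (-(1 / (d : ℝ))) ≤ 1 :=
    Real.rpow_le_one_of_one_le_of_nonpos (by linarith [(Nat.cast_nonneg n : (0 : ℝ) ≤ n)])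
      (by simp)
  have hpow0 : 0 < ((n : ℝ) + 1) ^ (-(1 / (d : ℝ))) := by positivity
  have hε1 : 2 * ε ≤ ((n : ℝ) + 1) ^ (-(1 / (d : ℝ))) := by
    have := min_le_left 1 (ρ : ℝ)
    rw [hε]; nlinarith
  have hε2 : 2 * ε ≤ ρ := by
    have := min_le_right 1 (ρ : ℝ)
    have h0 : 0 < min 1 (ρ : ℝ) := by positivity
    rw [hε]; nlinarith
  let t : ℕ → Set X := fun i => if h : i < n then Metric.closedBall l[i] ε else ∅
  have ht : ∀ i, Metric.ediam (t i) ≤ ENNReal.ofReal (2 * ε) := by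
    intro i
    by_cases h : i < n
    · simp only [t, dif_pos h]
      refine Metric.ediam_le_of_forall_dist_le fun x hx y hy => ?_
      have := dist_triangle_right x y l[i]
      rw [Metric.mem_closedBall] at hx hy
      linarith
    · simp [t, h]
  have hcov : (Set.univ : Set X) ⊆ ⋃ i, t i := by
    intro y _
    obtain ⟨x, hx, hxy⟩ := hcon y
    obtain ⟨i, hi, rfl⟩ := List.getElem_of_mem hx
    refine Set.mem_iUnion.2 ⟨i, ?_⟩
    simp only [t, dif_pos (show i < n from hi), Metric.mem_closedBall]
    rw [dist_comm]
    exact hxy.le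
  have htr : ∀ i, Metric.ediam (t i) ≤ r := fun i => (ht i).trans <| by
    refine le_trans (ENNReal.ofReal_le_ofReal hε2) ?_
    rw [ENNReal.ofReal_coe_nnreal]
    exact hρr.le
  refine absurd (lt_of_lt_of_le hlt (iInf_le_of_le t (iInf₂_le_of_le hcov htr le_rfl))) ?_
  rw [not_lt, tsum_eq_sum (s := Finset.range n)]
  · have hterm : ∀ i ∈ Finset.range n, (⨆ _ : (t i).Nonempty, Metric.ediam (t i) ^ (d : ℝ)) ≤
        ENNReal.ofReal (((n : ℝ) + 1)⁻¹) := by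
      intro i _
      refine iSup_le fun _ => ?_
      refine (ENNReal.rpow_le_rpow ((ht i).trans (ENNReal.ofReal_le_ofReal hε1)) hd0.le).trans ?_
      rw [ENNReal.ofReal_rpow_of_pos hpow0, ← Real.rpow_mul (by positivity),
        show -(1 / (d : ℝ)) * d = -1 by field_simp, Real.rpow_neg_one]
    refine (Finset.sum_le_sum hterm).trans ?_
    rw [Finset.sum_const, Finset.card_range, nsmul_eq_mul, ← ENNReal.ofReal_natCast,
      ← ENNReal.ofReal_mul (by positivity), ← ENNReal.ofReal_one]
    refine ENNReal.ofReal_le_ofReal ?_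
    rw [← div_eq_mul_inv, div_le_one (by positivity)]
    linarith
  · intro i hi
    have : t i = ∅ := by simp [t, Finset.mem_range.not.1 hi]
    simp [this]

end Separated

/-! ## A mass distribution principle -/

/-- The preimages of the sets of a cover exhaust `Z`, so by subadditivity their masses add up to at
least `m univ`; every sufficiently fine cover then has sum at least `K * m univ`, with `K`
arbitrary. -/
theorem caratheodoryMeasure_univ_eq_top_of_mass {Y Z : Type*} [MetricSpace Y] [MeasurableSpace Z]
    (m : Measure Z) [NeZero m] (Φ : Z → Y) (f : ℝ → ℝ)
    (h : ∀ K : ℕ, ∃ δ : ℝ, 0 < δ ∧ ∀ E : Set Y, IsClosed E → Metric.ediam E ≤ ENNReal.ofReal δ →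
      K * m (Φ ⁻¹' E) ≤ ENNReal.ofReal (f (Metric.diam E))) :
    caratheodoryMeasure f (Set.univ : Set Y) = ∞ := by
  have hK : ∀ K : ℕ, K * m Set.univ ≤ caratheodoryMeasure f (Set.univ : Set Y) := by
    intro K
    obtain ⟨δ, hδ, hE⟩ := h K
    refine le_iSup₂_of_le δ hδ (le_iInf fun E => le_iInf fun hc => le_iInf fun hcov =>
      le_iInf fun hd => ?_)
    calc K * m Set.univ ≤ K * ∑' i, m (Φ ⁻¹' E i) := by
          gcongr
          refine (measure_mono fun z _ => ?_).trans (measure_iUnion_le _)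
          rw [← Set.preimage_iUnion]
          exact hcov (Set.mem_univ _)
      _ = ∑' i, K * m (Φ ⁻¹' E i) := ENNReal.tsum_mul_left.symm
      _ ≤ _ := ENNReal.tsum_le_tsum fun i => hE _ (hc i) (hd i)
  have hm : m Set.univ ≠ 0 := by simpa using NeZero.ne m
  refine top_unique ?_
  rw [← ENNReal.top_mul hm, ← ENNReal.iSup_natCast, ENNReal.iSup_mul]
  exact iSup_le hK

/-- A closed set of small diameter has small mass in the image of the Cantor group, as soon as
changes in the first `M` coordinates are detected by the distance. -/
theorem measure_preimage_mul_two_pow_le {Y : Type*} [MetricSpace Y] (m : Measure (ℕ → ZMod 2))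
    [m.IsAddLeftInvariant] {Φ : (ℕ → ZMod 2) → Y} (hΦ : Continuous Φ) {M : ℕ} {s : ℝ≥0∞}
    (hs : ∀ b b', (∀ n, M ≤ n → b n = b' n) → b ≠ b' → s ≤ edist (Φ b) (Φ b'))
    {E : Set Y} (hE : IsClosed E) (hd : Metric.ediam E < s) :
    m (Φ ⁻¹' E) * 2 ^ M ≤ m Set.univ := by
  let g : (Fin M → ZMod 2) → ℕ → ZMod 2 := fun σ n => if h : n < M then σ ⟨n, h⟩ else 0
  let A : (Fin M → ZMod 2) → Set (ℕ → ZMod 2) := fun σ => (fun h => g σ + h) ⁻¹' (Φ ⁻¹' E)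
  have hA : ∀ σ, m (A σ) = m (Φ ⁻¹' E) := fun σ => measure_preimage_add m _ _
  have hmeas : ∀ σ, MeasurableSet (A σ) := fun σ =>
    ((hE.preimage hΦ).preimage (continuous_const.add continuous_id)).measurableSet
  -- A common point `h` of two translates would give two distinct sequences `g σ + h` and `g σ' +
  -- h`, equal from index `M` on, with both images in `E`: their distance is at least `s`, more than
  -- the diameter.
  have hdisj : Pairwise (Function.onFun Disjoint A) := by
    intro σ σ' hne
    refine Set.disjoint_left.2 fun h h1 h2 => hne ?_
    by_contra hne
    have hgne : g σ + h ≠ g σ' + h := by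
      intro heq
      refine hne (funext fun i => ?_)
      have := congrFun (add_right_cancel heq) i
      simpa [g] using this
    have := hs (g σ + h) (g σ' + h) (fun n hn => by simp [g, not_lt.2 hn]) hgne
    exact absurd (hd.trans_le this) (not_lt.2 (Metric.edist_le_ediam_of_mem h1 h2))
  have hsum := sum_measure_le_measure_univ (μ := m) (s := Finset.univ) (t := A)
    (fun σ _ => (hmeas σ).nullMeasurableSet) (fun σ _ σ' _ hne => (hdisj hne).aedisjoint)
  simp only [hA, Finset.sum_const, Finset.card_univ, Fintype.card_fun, ZMod.card, Fintype.card_fin,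
    nsmul_eq_mul] at hsum
  rw [mul_comm]
  exact_mod_cast hsum

/-- Exponentials of powers dominate the reciprocals of the functions of the intermediate scales. -/
theorem exists_le_two_pow_mul_powLogExp (c σ : ℝ) {η C K : ℝ} (hη : 0 < η) (hC : 0 < C)
    (hK : 0 < K) : ∃ δ : ℝ, 0 < δ ∧ ∀ r, 0 < r → r ≤ δ → ∃ M : ℕ,
      r < η * ((M : ℝ) + 1) ^ (-C) ∧ K ≤ 2 ^ M * powLogExp c σ r := by
  set b := η ^ (1 / C) with hb
  have hb0 : 0 < b := by positivity
  have hlog2 : 0 < Real.log 2 := Real.log_pos one_lt_two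
  have hexp : Tendsto (fun L : ℝ => Real.exp (1 / C * L)) atTop atTop :=
    Real.tendsto_exp_atTop.comp (tendsto_id.const_mul_atTop (by positivity))
  have h1 : ∀ᶠ L : ℝ in atTop, c * L ^ σ ≤ Real.log 2 * b / 4 * Real.exp (1 / C * L) := by
    have := ((isLittleO_rpow_exp_pos_mul_atTop σ (b := 1 / C) (by positivity)).const_mul_left
      c).bound (show 0 < Real.log 2 * b / 4 by positivity)
    filter_upwards [this] with L hL
    rw [Real.norm_eq_abs, Real.norm_eq_abs, Real.abs_exp] at hL
    exact (le_abs_self _).trans hL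
  have h2 : ∀ᶠ L : ℝ in atTop, Real.log 2 + Real.log K ≤
      Real.log 2 * b / 4 * Real.exp (1 / C * L) :=
    (hexp.const_mul_atTop (by positivity)).eventually_ge_atTop _
  have h3 : ∀ᶠ L : ℝ in atTop, 2 < b * Real.exp (1 / C * L) :=
    (hexp.const_mul_atTop hb0).eventually_gt_atTop _
  have hev := tendsto_log_one_div.eventually (h1.and (h2.and h3))
  rw [eventually_nhdsWithin_iff, Metric.eventually_nhds_iff] at hev
  obtain ⟨δ, hδ, hev⟩ := hev
  refine ⟨δ / 2, by positivity, fun r hr hrδ => ?_⟩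
  obtain ⟨h1, h2, h3⟩ := hev (by rw [Real.dist_eq, sub_zero, abs_of_pos hr]; linarith) hr
  set L := Real.log (1 / r)
  -- `y = (η / r)^(1/C)` is the critical value of `M + 1`. Taking `M = ⌊y/2⌋₊` keeps `M + 1 < y`
  -- since `y > 2`. Half of the resulting exponent `log 2 * y / 2` absorbs `c * L ^ σ`, the other
  -- half `log K` and the rounding loss `log 2`.
  set y := b * Real.exp (1 / C * L) with hy
  have hyC : y ^ C = η / r := by
    rw [hy, Real.mul_rpow hb0.le (Real.exp_pos _).le, hb, ← Real.rpow_mul hη.le,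
      one_div_mul_cancel hC.ne', Real.rpow_one, ← Real.exp_mul,
      show 1 / C * L * C = L by field_simp, Real.exp_log (by positivity)]
    ring
  have hMle : (⌊y / 2⌋₊ : ℝ) ≤ y / 2 := Nat.floor_le (by linarith)
  have hMlt : y / 2 < ⌊y / 2⌋₊ + 1 := Nat.lt_floor_add_one _
  refine ⟨⌊y / 2⌋₊, ?_, ?_⟩
  · have : ((⌊y / 2⌋₊ : ℝ) + 1) ^ C < η / r := by
      rw [← hyC]
      exact Real.rpow_lt_rpow (by positivity) (by linarith) hC
    rw [lt_div_iff₀ hr] at this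
    rw [Real.rpow_neg (by positivity), ← div_eq_mul_inv, lt_div_iff₀ (by positivity)]
    linarith
  · rw [powLogExp, if_neg hr.ne', ← Real.rpow_natCast, Real.rpow_def_of_pos two_pos,
      ← Real.exp_add]
    rw [← Real.log_le_iff_le_exp hK]
    change Real.log K ≤ Real.log 2 * ⌊y / 2⌋₊ + -(c * L ^ σ)
    have : Real.log 2 * (y / 2 - 1) ≤ Real.log 2 * ⌊y / 2⌋₊ :=
      mul_le_mul_of_nonneg_left (by linarith) hlog2.le
    have e : Real.log 2 * b / 4 * Real.exp (1 / C * L) = Real.log 2 * y / 4 := by rw [hy]; ring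
    rw [e] at h1 h2
    linarith

/-- Polynomial separation in the number `M` of free digits makes the Haar mass of small sets
exponentially small in a power of `1 / diam`, so the mass distribution principle applies to every
`c` and `σ`. -/
theorem caratheodoryMeasure_powLogExp_eq_top {Y : Type*} [MetricSpace Y]
    {Φ : (ℕ → ZMod 2) → Y} (hΦ : Continuous Φ) {η C : ℝ} (hη : 0 < η) (hC : 0 < C)
    (hs : ∀ (M : ℕ) b b', (∀ n, M ≤ n → b n = b' n) → b ≠ b' →
      ENNReal.ofReal (η * ((M : ℝ) + 1) ^ (-C)) ≤ edist (Φ b) (Φ b')) (c σ : ℝ) :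
    caratheodoryMeasure (powLogExp c σ) (Set.univ : Set Y) = ∞ := by
  let m : Measure (ℕ → ZMod 2) := Measure.addHaarMeasure ⊤
  have hm1 : m Set.univ = 1 := Measure.addHaarMeasure_self
  refine caratheodoryMeasure_univ_eq_top_of_mass m Φ _ fun K => ?_
  obtain ⟨δ, hδ, h⟩ := exists_le_two_pow_mul_powLogExp c σ hη hC
    -- `K + 1` replaces `K`, which may be `0`.
    (show (0 : ℝ) < K + 1 by positivity)
  refine ⟨δ, hδ, fun E hE hEd => ?_⟩
  have hfin : Metric.ediam E ≠ ∞ := ne_top_of_le_ne_top ENNReal.ofReal_ne_top hEd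
  have hdiam : Metric.ediam E = ENNReal.ofReal (Metric.diam E) := (ENNReal.ofReal_toReal hfin).symm
  have hmass : ∀ M : ℕ, Metric.diam E < η * ((M : ℝ) + 1) ^ (-C) → m (Φ ⁻¹' E) * 2 ^ M ≤ 1 := by
    intro M hM
    rw [← hm1]
    refine measure_preimage_mul_two_pow_le m hΦ (hs M) hE ?_
    rw [hdiam]
    exact (ENNReal.ofReal_lt_ofReal_iff (by positivity)).2 hM
  -- In diameter `0` the gauge vanishes, so the mass must vanish too: it is at most `2^(-M)` for
  -- every `M`.
  rcases (Metric.diam_nonneg (s := E)).eq_or_lt with h0 | hpos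
  · have hz : m (Φ ⁻¹' E) = 0 := by
      by_contra hne
      obtain ⟨M, hM⟩ := ENNReal.exists_nat_mul_gt hne ENNReal.one_ne_top
      refine absurd (hmass M (by rw [← h0]; positivity)) (not_le.2 (hM.trans_le ?_))
      rw [mul_comm]
      gcongr
      exact_mod_cast M.lt_two_pow_self.le
    simp [hz]
  · obtain ⟨M, hM, hKM⟩ := h _ hpos
      (by rw [hdiam] at hEd; exact (ENNReal.ofReal_le_ofReal_iff hδ.le).1 hEd)
    have hK : (K : ℝ≥0∞) ≤ 2 ^ M * ENNReal.ofReal (powLogExp c σ (Metric.diam E)) := by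
      rw [← ENNReal.ofReal_natCast, show (2 : ℝ≥0∞) ^ M = ENNReal.ofReal (2 ^ M) by
        rw [ENNReal.ofReal_pow (by norm_num), ENNReal.ofReal_ofNat],
        ← ENNReal.ofReal_mul (by positivity)]
      exact ENNReal.ofReal_le_ofReal (by linarith)
    calc K * m (Φ ⁻¹' E)
        ≤ 2 ^ M * ENNReal.ofReal (powLogExp c σ (Metric.diam E)) * m (Φ ⁻¹' E) := by gcongr
      _ = (m (Φ ⁻¹' E) * 2 ^ M) * ENNReal.ofReal (powLogExp c σ (Metric.diam E)) := by ring
      _ ≤ 1 * ENNReal.ofReal (powLogExp c σ (Metric.diam E)) := by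
          gcongr
          exact hmass M hM
      _ = _ := one_mul _

/-! ## A Cantor set of measures in the Wasserstein space -/

/-- Polynomial decay is essential: with geometric weights the same argument would allow only `M` of
order `log (1/r)`, hence a mass bound that is merely a power of `r`. -/
theorem exists_probabilityMeasure_nat_polynomial_weights :
    ∃ (l : Measure ℕ) (a : ℝ), IsProbabilityMeasure l ∧ 0 < a ∧
      ∀ n : ℕ, ENNReal.ofReal (a * ((n : ℝ) + 1) ^ (-2 : ℝ)) ≤ l {n} := by
  let w : ℕ → ℝ≥0∞ := fun n => ENNReal.ofReal (((n : ℝ) + 1) ^ (-2 : ℝ))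
  have hsum : Summable fun n : ℕ => ((n : ℝ) + 1) ^ (-2 : ℝ) := by
    have := (summable_nat_add_iff 1).2 (Real.summable_nat_rpow (p := -2) |>.2 (by norm_num))
    simpa using this
  have htop : tsum w ≠ ∞ := hsum.tsum_ofReal_ne_top
  have hpos : tsum w ≠ 0 := fun h => by
    have := ENNReal.tsum_eq_zero.1 h 0
    simp at this
  refine ⟨(PMF.normalize w hpos htop).toMeasure, (tsum w)⁻¹.toReal, inferInstance,
    ENNReal.toReal_pos (ENNReal.inv_ne_zero.2 htop) (ENNReal.inv_ne_top.2 hpos), fun n => ?_⟩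
  rw [PMF.toMeasure_apply_singleton _ _ (measurableSet_singleton n), PMF.normalize_apply, mul_comm,
    ENNReal.ofReal_mul (by positivity), ENNReal.ofReal_toReal (ENNReal.inv_ne_top.2 hpos)]

section Toggle

variable {X : Type*} [MetricSpace X]

theorem lintegral_edist_sq_lt_top [CompactSpace X] {α : Type*} [MeasurableSpace α] (m : Measure α)
    [IsFiniteMeasure m] (u v : α → X) : ∫⁻ x, edist (u x) (v x) ^ 2 ∂m < ∞ := by
  have hd : Metric.ediam (Set.univ : Set X) ≠ ∞ := isCompact_univ.isBounded.ediam_ne_top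
  calc ∫⁻ x, edist (u x) (v x) ^ 2 ∂m ≤ ∫⁻ _, Metric.ediam (Set.univ : Set X) ^ 2 ∂m := by
        gcongr
        exact Metric.edist_le_ediam_of_mem (Set.mem_univ _) (Set.mem_univ _)
    _ < ∞ := by
        rw [lintegral_const]
        exact ENNReal.mul_lt_top (ENNReal.pow_lt_top hd.lt_top) (measure_lt_top _ _)

/-- The point `p 0` or `p (n + 1)`, according to whether the `n`-th digit of `b` vanishes. -/
def togglePoint (p : ℕ → X) (b : ℕ → ZMod 2) (n : ℕ) : X := if b n = 0 then p 0 else p (n + 1)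

variable [MeasurableSpace X]

/-- The image of `l` under the map `n ↦ togglePoint p b n`. -/
def toggleMeasure (l : Measure ℕ) (p : ℕ → X) (b : ℕ → ZMod 2) : Measure X :=
  l.map (togglePoint p b)

instance (l : Measure ℕ) [IsProbabilityMeasure l] (p : ℕ → X) (b : ℕ → ZMod 2) :
    IsProbabilityMeasure (toggleMeasure l p b) :=
  Measure.isProbabilityMeasure_map (Measurable.of_discrete).aemeasurable

/-- The easy half of the Kantorovich duality. -/
theorem lintegral_le_add_wassersteinEDist [OpensMeasurableSpace X] [SecondCountableTopology X]
    {μ ν : Measure X} [IsProbabilityMeasure μ] {f : X → ℝ≥0∞} (hfm : Measurable f)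
    (hf : ∀ x y, f x ≤ f y + edist x y) :
    ∫⁻ x, f x ∂μ ≤ ∫⁻ x, f x ∂ν + wassersteinEDist μ ν := by
  refine ENNReal.le_of_forall_pos_le_add fun ε hε hfin => ?_
  obtain ⟨P, hP, hPlt⟩ := exists_plan_of_lt (ENNReal.lt_add_right
    (ne_top_of_le_ne_top hfin.ne le_add_self) (ENNReal.coe_ne_zero.2 hε.ne'))
  have := hP.isProbabilityMeasure
  calc ∫⁻ x, f x ∂μ = ∫⁻ q, f q.1 ∂P := by
        rw [← hP.1, Measure.fst, lintegral_map (by fun_prop) (by fun_prop)]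
    _ ≤ ∫⁻ q, (f q.2 + edist q.1 q.2) ∂P := lintegral_mono fun q => hf _ _
    _ = ∫⁻ q, f q.2 ∂P + ∫⁻ q, edist q.1 q.2 ∂P := lintegral_add_left (by fun_prop) _
    _ = ∫⁻ x, f x ∂ν + ∫⁻ q, edist q.1 q.2 ∂P := by
        rw [← hP.2, Measure.snd, lintegral_map (by fun_prop) (by fun_prop)]
    _ ≤ ∫⁻ x, f x ∂ν + (wassersteinEDist μ ν + ε) := by
        gcongr
        exact lintegral_edist_le_of_plan.trans hPlt.le
    _ = _ := (add_assoc _ _ _).symm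

/-- The test function is a cone of height `s` centred at `p (n + 1)`, vanishing at every other `p i`
with `i ≤ M`. Digit `n` contributes `s * l {n}` for `b` and nothing for `b'`, the other digits below
`M` contribute nothing, and the common digits from `M` on contribute equally, wherever their points
lie. Digit `k` uses `p (k + 1)`, so separation is needed up to index `M` included. -/
theorem mul_le_wassersteinEDist_toggleMeasure [OpensMeasurableSpace X] [SecondCountableTopology X]
    (l : Measure ℕ) [IsProbabilityMeasure l] {p : ℕ → X} {M n : ℕ} {s : ℝ≥0∞} (hs : s ≠ ∞)
    (hsep : ∀ i j, i ≤ M → j ≤ M → i ≠ j → s ≤ edist (p i) (p j)) (hn : n < M)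
    {b b' : ℕ → ZMod 2} (hbb : ∀ k, M ≤ k → b k = b' k) (hb : b n ≠ 0) (hb' : b' n = 0) :
    s * l {n} ≤ wassersteinEDist (toggleMeasure l p b) (toggleMeasure l p b') := by
  let f : X → ℝ≥0∞ := fun x => s - edist x (p (n + 1))
  have hfm : Measurable f := by fun_prop
  have hf : ∀ x y, f x ≤ f y + edist x y := fun x y => by
    rw [tsub_le_iff_right]
    calc s ≤ f y + edist y (p (n + 1)) := le_tsub_add
      _ ≤ f y + (edist x y + edist x (p (n + 1))) := by
          gcongr
          exact edist_triangle_left _ _ _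
      _ = _ := (add_assoc _ _ _).symm
  have hf0 : ∀ i, i ≤ M → i ≠ n + 1 → f (p i) = 0 := fun i hi hne =>
    tsub_eq_zero_of_le (hsep i (n + 1) hi (by omega) hne)
  have hint : ∀ b, ∫⁻ x, f x ∂(toggleMeasure l p b) = ∫⁻ k, f (togglePoint p b k) ∂l := fun b =>
    lintegral_map hfm Measurable.of_discrete
  have hpt : ∀ k, f (togglePoint p b k) =
      f (togglePoint p b' k) + Set.indicator {n} (fun _ => s) k := by
    intro k
    rcases le_or_gt M k with hk | hk
    · have : k ∉ ({n} : Set ℕ) := by simp; omega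
      rw [Set.indicator_of_notMem this, togglePoint, togglePoint, hbb k hk, add_zero]
    by_cases hkn : k = n
    · subst hkn
      rw [togglePoint, togglePoint, if_neg hb, if_pos hb', hf0 0 (by omega) (by omega)]
      simp [f]
    · have hz : ∀ b : ℕ → ZMod 2, f (togglePoint p b k) = 0 := by
        intro b
        rw [togglePoint]
        split_ifs
        · exact hf0 _ (by omega) (by omega)
        · exact hf0 _ (by omega) (by omega)
      rw [hz, hz, Set.indicator_of_notMem (by simpa using hkn), add_zero]
  have key := lintegral_le_add_wassersteinEDist (μ := toggleMeasure l p b)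
    (ν := toggleMeasure l p b') hfm hf
  rw [hint, hint, lintegral_congr hpt, lintegral_add_left Measurable.of_discrete,
    lintegral_indicator (measurableSet_singleton n), setLIntegral_const] at key
  -- The common term can be cancelled because it is finite, being at most `s`.
  refine (ENNReal.add_le_add_iff_left ?_).1 key
  refine ne_top_of_le_ne_top hs ?_
  calc ∫⁻ k, f (togglePoint p b' k) ∂l ≤ ∫⁻ _, s ∂l := lintegral_mono fun k => tsub_le_self
    _ = s := by simp

variable [CompactSpace X]

/-- The measure `toggleMeasure l p b`, as a point of the Wasserstein space. -/
def toggleWasserstein (l : Measure ℕ) [IsProbabilityMeasure l] (p : ℕ → X) (b : ℕ → ZMod 2) :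
    WassersteinTwo X :=
  ⟨toggleMeasure l p b, inferInstance, p 0, lintegral_edist_sq_lt_top _ (fun _ => p 0) id⟩

/-- Couple two toggled measures through the same index `k`. For fixed `k` the cost vanishes once
`b'` agrees with `b` at `k`, and the squared diameter of `X` dominates, so the total cost tends to
`0`. -/
theorem continuous_toggleWasserstein [BorelSpace X] (l : Measure ℕ) [IsProbabilityMeasure l]
    (p : ℕ → X) : Continuous (toggleWasserstein l p) := by
  rw [continuous_iff_continuousAt]
  intro b
  rw [ContinuousAt, tendsto_iff_edist_tendsto_0]
  have hle : ∀ b', edist (toggleWasserstein l p b') (toggleWasserstein l p b) ≤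
      (∫⁻ k, edist (togglePoint p b' k) (togglePoint p b k) ^ 2 ∂l) ^ (1 / 2 : ℝ) := by
    intro b'
    let T : ℕ → X × X := fun k => (togglePoint p b' k, togglePoint p b k)
    have hT : Measurable T := Measurable.of_discrete
    have hplan : IsTransportPlan (l.map T) (toggleMeasure l p b') (toggleMeasure l p b) := by
      constructor
      · rw [Measure.fst, Measure.map_map measurable_fst hT]
        rfl
      · rw [Measure.snd, Measure.map_map measurable_snd hT]
        rfl
    refine (wassersteinEDist_le hplan).trans_eq ?_
    rw [lintegral_map (by fun_prop) hT]
  refine tendsto_of_tendsto_of_tendsto_of_le_of_le tendsto_const_nhds ?_ (fun _ => zero_le) hle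
  have hlim : Tendsto (fun b' => ∫⁻ k, edist (togglePoint p b' k) (togglePoint p b k) ^ 2 ∂l)
      (𝓝 b) (𝓝 (∫⁻ _, 0 ∂l)) := by
    have hd : Metric.ediam (Set.univ : Set X) ≠ ∞ := isCompact_univ.isBounded.ediam_ne_top
    refine tendsto_lintegral_filter_of_dominated_convergence
      (fun _ => Metric.ediam (Set.univ : Set X) ^ 2)
      (Eventually.of_forall fun _ => Measurable.of_discrete)
      (Eventually.of_forall fun b' => Eventually.of_forall fun k => ?_) ?_
      (Eventually.of_forall fun k => ?_)
    · gcongr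
      exact Metric.edist_le_ediam_of_mem (Set.mem_univ _) (Set.mem_univ _)
    · rw [lintegral_const]
      exact (ENNReal.mul_lt_top (ENNReal.pow_lt_top hd.lt_top) (measure_lt_top _ _)).ne
    · have hk : ∀ᶠ b' in 𝓝 b, b' k = b k :=
        (continuous_apply k).tendsto b ((isOpen_discrete {b k}).mem_nhds rfl)
      refine tendsto_const_nhds.congr' ?_
      filter_upwards [hk] with b' hb'
      simp [togglePoint, hb']
  rw [lintegral_zero] at hlim
  have := hlim.ennrpow_const (1 / 2)
  simpa using this

end Toggle

/-- The Wasserstein space of a compact space of positive dimension is large at every scale which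
is subexponential in a power of `1 / r`. -/
theorem caratheodoryMeasure_powLogExp_wassersteinTwo {X : Type*} [MetricSpace X] [CompactSpace X]
    [MeasurableSpace X] [BorelSpace X] (hX : 0 < dimH (Set.univ : Set X)) (c σ : ℝ) :
    caratheodoryMeasure (powLogExp c σ) (Set.univ : Set (WassersteinTwo X)) = ∞ := by
  obtain ⟨η, C, hη, hC, p, hp⟩ := exists_separated_seq hX
  obtain ⟨l, a, hl, ha, hla⟩ := exists_probabilityMeasure_nat_polynomial_weights
  -- In the exponent, `C` comes from the separation of the points and `2` from the weights.
  refine caratheodoryMeasure_powLogExp_eq_top (continuous_toggleWasserstein l p)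
    (mul_pos hη ha) (show 0 < C + 2 by linarith) (fun M b b' hbb hne => ?_) c σ
  have hM : (0 : ℝ) < (M : ℝ) + 1 := by positivity
  have hlt : ∀ i j, j ≤ M → i < j →
      ENNReal.ofReal (η * ((M : ℝ) + 1) ^ (-C)) ≤ edist (p i) (p j) := by
    intro i j hj hij
    rw [edist_dist]
    refine ENNReal.ofReal_le_ofReal (le_trans ?_ (hp i j hij))
    gcongr ?_ * ?_
    exact Real.rpow_le_rpow_of_nonpos (by positivity) (by gcongr) (by linarith)
  have hsep : ∀ i j, i ≤ M → j ≤ M → i ≠ j →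
      ENNReal.ofReal (η * ((M : ℝ) + 1) ^ (-C)) ≤ edist (p i) (p j) := by
    intro i j hi hj hij
    rcases hij.lt_or_gt with h | h
    · exact hlt i j hj h
    · rw [edist_comm]
      exact hlt j i hi h
  obtain ⟨n, hn⟩ := Function.ne_iff.1 hne
  have hnM : n < M := by
    by_contra h
    exact hn (hbb n (not_lt.1 h))
  have hw : ENNReal.ofReal (η * a * ((M : ℝ) + 1) ^ (-(C + 2))) ≤
      ENNReal.ofReal (η * ((M : ℝ) + 1) ^ (-C)) * l {n} := by
    calc ENNReal.ofReal (η * a * ((M : ℝ) + 1) ^ (-(C + 2)))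
        = ENNReal.ofReal (η * ((M : ℝ) + 1) ^ (-C)) *
            ENNReal.ofReal (a * ((M : ℝ) + 1) ^ (-2 : ℝ)) := by
          rw [← ENNReal.ofReal_mul (by positivity), neg_add, Real.rpow_add hM]
          congr 1
          ring
      _ ≤ ENNReal.ofReal (η * ((M : ℝ) + 1) ^ (-C)) *
            ENNReal.ofReal (a * ((n : ℝ) + 1) ^ (-2 : ℝ)) := by
          have : ((M : ℝ) + 1) ^ (-2 : ℝ) ≤ ((n : ℝ) + 1) ^ (-2 : ℝ) :=
            Real.rpow_le_rpow_of_nonpos (by positivity) (by gcongr) (by norm_num)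
          exact mul_le_mul_right (ENNReal.ofReal_le_ofReal (mul_le_mul_of_nonneg_left this ha.le)) _
      _ ≤ _ := by
          gcongr
          exact hla n
  refine hw.trans ?_
  -- Exactly one of the two digits at `n` vanishes; symmetry of the distance allows it to be that of
  -- `b'`.
  by_cases hb : b n = 0
  · rw [edist_comm]
    exact mul_le_wassersteinEDist_toggleMeasure l ENNReal.ofReal_ne_top hsep hnM
      (fun k hk => (hbb k hk).symm) (fun h => hn (hb.trans h.symm)) hb
  · have hb' : b' n = 0 := by
      generalize b n = x at *
      generalize b' n = y at *
      revert x y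
      decide
    exact mul_le_wassersteinEDist_toggleMeasure l ENNReal.ofReal_ne_top hsep hnM hbb hb hb'

/-! ### Critical parameters and conclusion -/

theorem Scale.crit_eq_top {F : Scale} {Y : Type*} [MetricSpace Y] {A : Set Y}
    (hF : ∀ x : ℝ, ∃ s ∈ F.I, x ≤ s) (h : ∀ s ∈ F.I, caratheodoryMeasure (F.f s) A = ∞) :
    F.crit A = ⊤ := by
  refine EReal.eq_top_iff_forall_lt _ |>.2 fun x => ?_
  obtain ⟨s, hs, hxs⟩ := hF (x + 1)
  refine lt_of_lt_of_le (EReal.coe_lt_coe_iff.2 (by linarith : x < s)) ?_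
  exact le_sup_of_le_right (le_iSup₂_of_le s hs (le_iSup_of_le (h s hs) le_rfl))

theorem mainTheorem6 {X : Type*} [MetricSpace X] [CompactSpace X] [MeasurableSpace X]
    [BorelSpace X] (hX : 0 < dimH (Set.univ : Set X)) :
    HasAtLeastIntermediateSize (WassersteinTwo X) ∧
    2 ≤ coarseIntermediateScale.crit (Set.univ : Set (WassersteinTwo X)) ∧
    ((dimH (Set.univ : Set X) : ℝ≥0∞) : EReal) / ((2 * Real.log 3 : ℝ) : EReal) ≤
      (fineIntermediateScale 2 one_le_two).crit (Set.univ : Set (WassersteinTwo X)) := by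
  have hcoarse : coarseIntermediateScale.crit (Set.univ : Set (WassersteinTwo X)) = ⊤ :=
    Scale.crit_eq_top (fun x => ⟨max x 1, Set.mem_Ici.2 (le_max_right x 1), le_max_left x 1⟩)
      fun s _ => caratheodoryMeasure_powLogExp_wassersteinTwo hX 1 s
  have hfine : (fineIntermediateScale 2 one_le_two).crit (Set.univ : Set (WassersteinTwo X)) = ⊤ :=
    Scale.crit_eq_top
      (fun x => ⟨max x 1, zero_lt_one.trans_le (le_max_right x 1), le_max_left _ _⟩)
      fun s _ => caratheodoryMeasure_powLogExp_wassersteinTwo hX s 2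
  refine ⟨?_, ?_, ?_⟩
  · rw [HasAtLeastIntermediateSize, hcoarse]
    exact EReal.coe_lt_top 1
  · rw [hcoarse]
    exact le_top
  · rw [hfine]
    exact le_top

end
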